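/- Let $F_n$ and $L_n$ ($n\in\mathbb Z$) be the Fibonacci and Lucas numbers: $F_0=0$, $F_1=1$, $L_0=2$, $L_1=1$, $X_n=X_{n-1}+X_{n-2}$ for $n\ge 2$, extended to negative indices by $F_{-j}=(-1)^{j-1}F_j$ and $L_{-j}=(-1)^jL_j$. Let $\alpha=(1+\sqrt5)/2$, and let $\sqrt[3]{x}$ denote the real cube root of a real number $x$. Let $p$ and $q$ be integers such that $p\le -2$, $q\ge 4$ and $q>|p|+1$. Then both of the following series converge, and \begin{align*} \sum_{k=1}^\infty & \Big(\frac{-27F_pF_{p+q}}{F_q^2}\Big)^{k}\frac{F_{(2p+q)k}}{k^2\binom{3k}{k}}\\ &=\frac{6}{\sqrt5}\Bigg(\arctan^2\!\bigg(\frac{\sqrt3\,\sqrt[3]{F_{p+q}}}{2\sqrt[3]{\alpha^qF_p}+\sqrt[3]{F_{p+q}}}\bigg)-\arctan^2\!\bigg(\frac{\sqrt3\,\sqrt[3]{F_p}}{2\sqrt[3]{\alpha^qF_{p+q}}+(-1)^q\sqrt[3]{F_p}}\bigg)\Bigg)\\ &\quad-\frac{\sqrt5}{10}\Bigg(\log^2\!\bigg(\frac{(-1)^pF_q}{\big(\sqrt[3]{\alpha^pF_{p+q}}-\sqrt[3]{\alpha^{p+q}F_p}\big)^3}\bigg)-\log^2\!\bigg(\frac{\alpha^{p+q}F_q}{\big(\sqrt[3]{\alpha^qF_{p+q}}-(-1)^q\sqrt[3]{F_p}\big)^3}\bigg)\Bigg),\\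 \sum_{k=1}^\infty & \Big(\frac{-27F_pF_{p+q}}{F_q^2}\Big)^{k}\frac{L_{(2p+q)k}}{k^2\binom{3k}{k}}\\ &=6\Bigg(\arctan^2\!\bigg(\frac{\sqrt3\,\sqrt[3]{F_{p+q}}}{2\sqrt[3]{\alpha^qF_p}+\sqrt[3]{F_{p+q}}}\bigg)+\arctan^2\!\bigg(\frac{\sqrt3\,\sqrt[3]{F_p}}{2\sqrt[3]{\alpha^qF_{p+q}}+(-1)^q\sqrt[3]{F_p}}\bigg)\Bigg)\\ &\quad-\frac12\Bigg(\log^2\!\bigg(\frac{(-1)^pF_q}{\big(\sqrt[3]{\alpha^pF_{p+q}}-\sqrt[3]{\alpha^{p+q}F_p}\big)^3}\bigg)+\log^2\!\bigg(\frac{\alpha^{p+q}F_q}{\big(\sqrt[3]{\alpha^qF_{p+q}}-(-1)^q\sqrt[3]{F_p}\big)^3}\bigg)\Bigg). \end{align*} -/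

import Mathlib

/-- The Lucas numbers with nonnegative index: `L₀ = 2`, `L₁ = 1`, `Lₙ₊₂ = Lₙ₊₁ + Lₙ`. -/
def lucasNat : ℕ → ℤ
  | 0 => 2
  | 1 => 1
  | (n + 2) => lucasNat (n + 1) + lucasNat n

/-- The Lucas numbers for integer index, with `L₋ⱼ = (-1) ^ j * Lⱼ`. -/
def lucasInt (n : ℤ) : ℤ :=
  if 0 ≤ n then lucasNat n.toNat else (-1) ^ n.natAbs * lucasNat n.natAbs

/-- The real cube root of a real number, odd in its argument. -/
noncomputable def cubeRoot (x : ℝ) : ℝ :=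
  if 0 ≤ x then x ^ (1 / 3 : ℝ) else -((-x) ^ (1 / 3 : ℝ))

theorem cubeRoot_pow_three (x : ℝ) : cubeRoot x ^ 3 = x := by
  unfold cubeRoot
  split_ifs with h
  · rw [← Real.rpow_natCast, ← Real.rpow_mul h]; norm_num
  · have h' : 0 ≤ -x := by linarith
    rw [Odd.neg_pow (by decide), ← Real.rpow_natCast, ← Real.rpow_mul h']; norm_num

/-! With `S(x) = ∑ xⁿ / (n² (3n choose n))` and `x = -27 u³ / (1 - u³)²`, one has `S(x) = 6 A² - L²
/ 2`, where `A = cubicAngle u` and `L = cubicLog u` (`powerSum_invSqChoose_cubicArg`). The ratio of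
consecutive coefficients is rational in `n`, so `S'` satisfies a linear second-order equation; in
the variable `u` it becomes one whose successive integrals are elementary.

Write `α`, `β` for the golden ratio and its conjugate. Taking `u³ = F_{p+q} / (α^q F_p)` turns `x`
into `-27 F_p F_{p+q} / F_q² * α^(2p+q)`, and `u³ = (-1)^q F_p / (α^q F_{p+q})` gives the same with
`β`. The index bounds place both values of `u` in `(-1, 1/2)`, where the closed form holds. Binet's
formulas then combine `hasSum_goldenRatio` and `hasSum_goldenConj`: the difference over `√5` is the
Fibonacci series, the sum is the Lucas series. -/

/-! ### Termwise differentiation of power series -/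

/-- The coefficients of the power series `∑ aₙ xⁿ` grow at most like a polynomial times `ρⁿ`. -/
def IsGeomBounded (ρ : ℝ) (a : ℕ → ℝ) : Prop :=
  ∃ (K : ℝ) (d : ℕ), 0 ≤ K ∧ ∀ n, |a n| ≤ K * ((n : ℝ) + 1) ^ d * ρ ^ n

/-- The coefficients of the formal derivative of `∑ aₙ xⁿ`. -/
def derivCoeff (a : ℕ → ℝ) (n : ℕ) : ℝ := ((n : ℝ) + 1) * a (n + 1)

/-- The sum of the power series with coefficients `a`. -/
noncomputable def powerSum (a : ℕ → ℝ) (x : ℝ) : ℝ := ∑' n, a n * x ^ n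

/-- The polynomial factor absorbs `n + 1`, so `ρ` survives repeated differentiation. -/
theorem IsGeomBounded.derivCoeff {ρ : ℝ} (hρ : 0 ≤ ρ) {a : ℕ → ℝ} (h : IsGeomBounded ρ a) :
    IsGeomBounded ρ (derivCoeff a) := by
  obtain ⟨K, d, hK, h⟩ := h
  refine ⟨K * 2 ^ d * ρ, d + 1, by positivity, fun n => ?_⟩
  have h1 := h (n + 1)
  have hn : (0 : ℝ) ≤ n := n.cast_nonneg
  have h2 : ((n : ℝ) + 1 + 1) ^ d ≤ (2 * ((n : ℝ) + 1)) ^ d := by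
    gcongr; linarith
  rw [_root_.derivCoeff, abs_mul, abs_of_nonneg (by positivity)]
  push_cast at h1
  calc ((n : ℝ) + 1) * |a (n + 1)|
      ≤ ((n : ℝ) + 1) * (K * (2 * ((n : ℝ) + 1)) ^ d * ρ ^ (n + 1)) := by
        gcongr
        exact h1.trans (by gcongr)
    _ = _ := by rw [mul_pow]; ring

theorem IsGeomBounded.summable_majorant {ρ r K : ℝ} (d : ℕ) (hρ : 0 ≤ ρ) (hr : 0 ≤ r)
    (hρr : ρ * r < 1) : Summable fun n : ℕ => K * ((n : ℝ) + 1) ^ d * ρ ^ n * r ^ n := by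
  have hnn : 0 ≤ ρ * r := by positivity
  have h := summable_pow_mul_geometric_of_norm_lt_one (R := ℝ) d (r := ρ * r)
    (by rwa [Real.norm_of_nonneg hnn])
  have h0 := summable_geometric_of_lt_one hnn hρr
  refine Summable.of_norm_bounded (((h.add h0).mul_left (|K| * 2 ^ d))) fun n => ?_
  have hn : (0 : ℝ) ≤ n := n.cast_nonneg
  -- The summand `1` covers `n = 0`, where `n ^ d` vanishes unless `d = 0`.
  have h2 : ((n : ℝ) + 1) ^ d ≤ 2 ^ d * ((n : ℝ) ^ d + 1) := by
    rcases Nat.eq_zero_or_pos n with rfl | hpos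
    · have : (1 : ℝ) ≤ 2 ^ d := one_le_pow₀ (by norm_num)
      have h0d : (0 : ℝ) ≤ (0 : ℝ) ^ d := by positivity
      simp only [Nat.cast_zero, zero_add, one_pow]
      nlinarith
    · have h1 : (1 : ℝ) ≤ n := by exact_mod_cast hpos
      calc ((n : ℝ) + 1) ^ d ≤ (2 * (n : ℝ)) ^ d := by gcongr; linarith
        _ = 2 ^ d * (n : ℝ) ^ d := mul_pow _ _ _
        _ ≤ _ := by gcongr; linarith
  rw [Real.norm_eq_abs, abs_mul, abs_mul, abs_mul, abs_of_nonneg (by positivity : 0 ≤ ρ ^ n),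
    abs_of_nonneg (by positivity : 0 ≤ r ^ n),
    abs_of_nonneg (by positivity : 0 ≤ ((n : ℝ) + 1) ^ d)]
  calc |K| * ((n : ℝ) + 1) ^ d * ρ ^ n * r ^ n
      ≤ |K| * (2 ^ d * ((n : ℝ) ^ d + 1)) * ρ ^ n * r ^ n := by gcongr
    _ = _ := by rw [mul_pow]; ring

theorem IsGeomBounded.summable {ρ : ℝ} (hρ : 0 ≤ ρ) {a : ℕ → ℝ} (h : IsGeomBounded ρ a) {x : ℝ}
    (hx : ρ * |x| < 1) : Summable fun n => a n * x ^ n := by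
  obtain ⟨K, d, -, h⟩ := h
  refine Summable.of_norm_bounded (IsGeomBounded.summable_majorant (K := K) d hρ (abs_nonneg x) hx)
    fun n => ?_
  rw [Real.norm_eq_abs, abs_mul, abs_pow]
  gcongr
  exact h n

theorem hasDerivAt_powerSum {ρ : ℝ} (hρ : 0 < ρ) {a : ℕ → ℝ} (h : IsGeomBounded ρ a) {x : ℝ}
    (hx : ρ * |x| < 1) : HasDerivAt (powerSum a) (powerSum (derivCoeff a) x) x := by
  obtain ⟨r, hxr, hr⟩ : ∃ r, |x| < r ∧ ρ * r < 1 := by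
    obtain ⟨r, h1, h2⟩ := exists_between (show |x| < 1 / ρ by rw [lt_div_iff₀ hρ]; linarith)
    exact ⟨r, h1, by rw [lt_div_iff₀ hρ] at h2; linarith⟩
  have hr0 : 0 < r := (abs_nonneg x).trans_lt hxr
  have hd := h.derivCoeff hρ.le
  obtain ⟨K, d, -, hb⟩ := hd
  have hmaj := IsGeomBounded.summable_majorant (K := K) d hρ.le hr0.le hr
  have hmem : x ∈ Set.Ioo (-r) r := abs_lt.1 hxr
  have hsum := (h.derivCoeff hρ.le).summable hρ.le hx
  -- The term at `n = 0` is zero despite the truncated `n - 1`; shifting the index by one yields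
  -- `derivCoeff a`.
  let g' : ℕ → ℝ → ℝ := fun n y => a n * ((n : ℝ) * y ^ (n - 1))
  have key := hasDerivAt_tsum_of_isPreconnected (𝕜 := ℝ)
    (u := fun n : ℕ => |a n| * ((n : ℝ) * r ^ (n - 1))) (t := Set.Ioo (-r) r)
    (g := fun n y => a n * y ^ n) (g' := g') (y₀ := 0) (y := x) ?_ isOpen_Ioo
    isPreconnected_Ioo ?_ ?_ ⟨by linarith, hr0⟩ ?_ hmem
  · have hg' : Summable fun n => g' n x := by
      rw [← summable_nat_add_iff 1]
      refine hsum.congr fun n => ?_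
      simp only [g', derivCoeff, Nat.add_sub_cancel, Nat.cast_add, Nat.cast_one]; ring
    have he : ∑' n, g' n x = powerSum (derivCoeff a) x := by
      rw [hg'.tsum_eq_zero_add, powerSum]
      simp only [g', derivCoeff, Nat.add_sub_cancel, Nat.cast_add, Nat.cast_one, Nat.cast_zero,
        zero_mul, mul_zero, zero_add]
      exact tsum_congr fun n => by ring
    rw [← he]
    exact key
  · rw [← summable_nat_add_iff 1]
    refine Summable.of_nonneg_of_le (fun n => by positivity) (fun n => ?_) hmaj
    have := hb n
    rw [derivCoeff, abs_mul, abs_of_nonneg (by positivity : (0 : ℝ) ≤ (n : ℝ) + 1)] at this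
    calc |a (n + 1)| * (((n + 1 : ℕ) : ℝ) * r ^ (n + 1 - 1))
        = (((n : ℝ) + 1) * |a (n + 1)|) * r ^ n := by
          rw [Nat.add_sub_cancel]; push_cast; ring
      _ ≤ _ := by gcongr
  · intro n y _
    exact (hasDerivAt_pow n y).const_mul (a n)
  · intro n y hy
    have hy' : |y| ≤ r := (abs_lt.2 hy).le
    simp only [g']
    rw [Real.norm_eq_abs, abs_mul, abs_mul, abs_pow, Nat.abs_cast]
    gcongr
  · exact h.summable hρ.le (by simp)

/-! ### The coefficients and their differential equation -/

/-- The coefficient `1 / (n² (3n choose n))`, with value `0` at `n = 0`. -/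
noncomputable def invSqChoose (n : ℕ) : ℝ := 1 / ((n : ℝ) ^ 2 * (Nat.choose (3 * n) n : ℝ))

theorem choose_three_mul_succ (n : ℕ) :
    (Nat.choose (3 * (n + 1)) (n + 1) : ℝ) * (2 * (n + 1) * (2 * n + 1)) =
      3 * (3 * n + 2) * (3 * n + 1) * Nat.choose (3 * n) n := by
  have h1 := Nat.add_choose_mul_factorial_mul_factorial (2 * n) n
  have h2 := Nat.add_choose_mul_factorial_mul_factorial (2 * (n + 1)) (n + 1)
  rw [show 2 * n + n = 3 * n by ring] at h1
  rw [show 2 * (n + 1) + (n + 1) = 3 * (n + 1) by ring] at h2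
  rw [show (3 * (n + 1)).factorial = (3 * n + 3) * ((3 * n + 2) * ((3 * n + 1) * (3 * n).factorial))
      by rw [show 3 * (n + 1) = 3 * n + 1 + 1 + 1 by ring]; simp only [Nat.factorial_succ],
    show (2 * (n + 1)).factorial = (2 * n + 2) * ((2 * n + 1) * (2 * n).factorial)
      by rw [show 2 * (n + 1) = 2 * n + 1 + 1 by ring]; simp only [Nat.factorial_succ],
    Nat.factorial_succ n, ← h1] at h2
  have h2' : ((Nat.choose (3 * (n + 1)) (n + 1) : ℝ) * ((2 * n + 2) * ((2 * n + 1) *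
      (2 * n).factorial)) * ((n + 1) * n.factorial)) = (3 * n + 3) * ((3 * n + 2) * ((3 * n + 1) *
      (Nat.choose (3 * n) n * (2 * n).factorial * n.factorial))) := by exact_mod_cast h2
  have f1 : ((2 * n).factorial : ℝ) ≠ 0 := by exact_mod_cast Nat.factorial_ne_zero _
  have f2 : (n.factorial : ℝ) ≠ 0 := by exact_mod_cast Nat.factorial_ne_zero _
  have f3 : ((n : ℝ) + 1) ≠ 0 := by positivity
  refine mul_right_cancel₀ (mul_ne_zero (mul_ne_zero f1 f2) f3) ?_
  linear_combination h2'

theorem choose_three_mul_pos (n : ℕ) : (0 : ℝ) < Nat.choose (3 * n) n := by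
  exact_mod_cast Nat.choose_pos (by omega)

theorem derivCoeff_invSqChoose (n : ℕ) :
    derivCoeff invSqChoose n = 1 / (((n : ℝ) + 1) * Nat.choose (3 * (n + 1)) (n + 1)) := by
  have := choose_three_mul_pos (n + 1)
  rw [derivCoeff, invSqChoose]
  push_cast
  field_simp

/-- The left factor is `3 (3n + 4) (3n + 5)`, written in powers of `n + 1` so that both sides of the
recurrence become differential operators in `x d/dx`. -/
theorem derivCoeff_invSqChoose_succ (n : ℕ) :
    (27 * ((n : ℝ) + 1) ^ 2 + 27 * (n + 1) + 6) * derivCoeff invSqChoose (n + 1) =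
      (4 * (n : ℝ) ^ 2 + 10 * n + 6) * derivCoeff invSqChoose n := by
  have h1 := choose_three_mul_pos (n + 1)
  have h2 := choose_three_mul_pos (n + 1 + 1)
  have h := choose_three_mul_succ (n + 1)
  rw [derivCoeff_invSqChoose, derivCoeff_invSqChoose]
  push_cast at h ⊢
  rw [mul_one_div, mul_one_div, div_eq_div_iff (by positivity) (by positivity)]
  linear_combination (-(((n : ℝ) + 1))) * h

theorem derivCoeff_invSqChoose_zero : derivCoeff invSqChoose 0 = 1 / 3 := by
  rw [derivCoeff_invSqChoose]; norm_num

theorem derivCoeff_invSqChoose_pos (n : ℕ) : 0 < derivCoeff invSqChoose n := by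
  have := choose_three_mul_pos (n + 1)
  rw [derivCoeff_invSqChoose]; positivity

theorem derivCoeff_invSqChoose_le (n : ℕ) :
    derivCoeff invSqChoose n ≤ 1 / 3 * (4 / 27 : ℝ) ^ n := by
  induction n with
  | zero => rw [derivCoeff_invSqChoose_zero]; norm_num
  | succ n ih =>
    have h := derivCoeff_invSqChoose_succ n
    have hp := derivCoeff_invSqChoose_pos n
    have hn : (0 : ℝ) ≤ n := n.cast_nonneg
    have h1 : derivCoeff invSqChoose (n + 1) ≤ 4 / 27 * derivCoeff invSqChoose n := by
      have hE : 0 < 27 * ((n : ℝ) + 1) ^ 2 + 27 * (n + 1) + 6 := by positivity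
      refine le_of_mul_le_mul_left ?_ hE
      rw [h, ← mul_assoc]
      gcongr
      nlinarith
    rw [pow_succ]
    linarith

theorem isGeomBounded_invSqChoose : IsGeomBounded (4 / 27) invSqChoose := by
  -- `9 / 4 = (1 / 3) / (4 / 27)` accounts for the index shift in `derivCoeff_invSqChoose_le`.
  refine ⟨9 / 4, 0, by norm_num, fun n => ?_⟩
  rw [pow_zero, mul_one]
  rcases n with _ | n
  · norm_num [invSqChoose]
  · have h := derivCoeff_invSqChoose_le n
    have hpos : 0 < invSqChoose (n + 1) := by
      have := choose_three_mul_pos (n + 1)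
      rw [invSqChoose]; positivity
    have hn : (0 : ℝ) ≤ n := n.cast_nonneg
    rw [derivCoeff] at h
    rw [abs_of_pos hpos, pow_succ]
    nlinarith

theorem mul_powerSum_derivCoeff {ρ : ℝ} (hρ : 0 ≤ ρ) {a : ℕ → ℝ} (h : IsGeomBounded ρ a) {x : ℝ}
    (hx : ρ * |x| < 1) : HasSum (fun n => n * a n * x ^ n) (x * powerSum (derivCoeff a) x) := by
  have hs := ((h.derivCoeff hρ).summable hρ hx).hasSum.mul_left x
  rw [← hasSum_nat_add_iff' 1]
  simp only [Finset.sum_range_one, Nat.cast_zero, zero_mul, sub_zero]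
  refine hs.congr_fun fun n => ?_
  rw [derivCoeff]; push_cast; ring

/-- The differential equation of the derivative of `∑ xⁿ / (n² (3n choose n))`. -/
theorem powerSum_invSqChoose_ode {x : ℝ} (hx : 4 / 27 * |x| < 1) :
    (27 * x ^ 2 - 4 * x ^ 3) *
        powerSum (derivCoeff (derivCoeff (derivCoeff invSqChoose))) x +
      (54 * x - 14 * x ^ 2) * powerSum (derivCoeff (derivCoeff invSqChoose)) x +
      (6 - 6 * x) * powerSum (derivCoeff invSqChoose) x = 2 := by
  have hρ : (0 : ℝ) ≤ 4 / 27 := by norm_num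
  have hb := isGeomBounded_invSqChoose.derivCoeff hρ
  set b := derivCoeff invSqChoose with hbdef
  have s0 : HasSum (fun n => b n * x ^ n) (powerSum b x) := (hb.summable hρ hx).hasSum
  have s1 := mul_powerSum_derivCoeff hρ hb hx
  have s2 : HasSum (fun n : ℕ => (n : ℝ) * (n - 1) * b n * x ^ n)
      (x ^ 2 * powerSum (derivCoeff (derivCoeff b)) x) := by
    have hs := (mul_powerSum_derivCoeff hρ (hb.derivCoeff hρ) hx).mul_left x
    rw [← hasSum_nat_add_iff' 1]
    simp only [Finset.sum_range_one, Nat.cast_zero, zero_mul, sub_zero]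
    rw [← mul_assoc, ← sq] at hs
    refine hs.congr_fun fun n => ?_
    simp only [derivCoeff]; push_cast; ring
  have t1 : HasSum (fun n : ℕ => (27 * (n : ℝ) ^ 2 + 27 * n + 6) * b n * x ^ n)
      (27 * (x ^ 2 * powerSum (derivCoeff (derivCoeff b)) x) + 54 * (x * powerSum (derivCoeff b) x)
        + 6 * powerSum b x) := by
    refine (((s2.mul_left 27).add (s1.mul_left 54)).add (s0.mul_left 6)).congr_fun fun n => ?_
    ring
  have t2 : HasSum (fun n : ℕ => (27 * ((n : ℝ) + 1) ^ 2 + 27 * (n + 1) + 6) * b (n + 1) *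
        x ^ (n + 1))
      (x * (4 * (x ^ 2 * powerSum (derivCoeff (derivCoeff b)) x) +
        14 * (x * powerSum (derivCoeff b) x) + 6 * powerSum b x)) := by
    refine ((((s2.mul_left 4).add (s1.mul_left 14)).add (s0.mul_left 6)).mul_left x).congr_fun
      fun n => ?_
    rw [derivCoeff_invSqChoose_succ n, pow_succ]
    ring
  -- The constant term removed here, `6 * b 0 = 2`, is the right-hand side of the equation.
  rw [← hasSum_nat_add_iff' 1] at t1
  simp only [Finset.sum_range_one, Nat.cast_add, Nat.cast_one, Nat.cast_zero] at t1
  have he := t1.unique t2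
  rw [hbdef, derivCoeff_invSqChoose_zero, ← hbdef] at he
  linear_combination he

/-! ### Closed form under the cubic parametrization -/

theorem eqOn_Ioo_of_hasDerivAt {a b : ℝ} (ha : a < 0) (hb : 0 < b) {f g f' : ℝ → ℝ}
    (hf : ∀ u ∈ Set.Ioo a b, HasDerivAt f (f' u) u)
    (hg : ∀ u ∈ Set.Ioo a b, HasDerivAt g (f' u) u) (h0 : f 0 = g 0) :
    Set.EqOn f g (Set.Ioo a b) :=
  isOpen_Ioo.eqOn_of_deriv_eq isPreconnected_Ioo
    (fun u hu => (hf u hu).differentiableAt.differentiableWithinAt)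
    (fun u hu => (hg u hu).differentiableAt.differentiableWithinAt)
    (fun u hu => (hf u hu).deriv.trans (hg u hu).deriv.symm) (x := 0) ⟨ha, hb⟩ h0

/-- The rational parametrization of the argument of the series. -/
noncomputable def cubicArg (u : ℝ) : ℝ := -27 * u ^ 3 / (1 - u ^ 3) ^ 2

/-- With `ω = exp(2πi/3)` and `-1 < u < 1`, this is `-arg(1 - ω u)`, and `cubicLog u` is `2 log(|1 -
ω u| / (1 - u))`. -/
noncomputable def cubicAngle (u : ℝ) : ℝ := Real.arctan (√3 * u / (u + 2))

noncomputable def cubicLog (u : ℝ) : ℝ := Real.log ((1 - u ^ 3) / (1 - u) ^ 3)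

/-- A primitive of `1 / (1 - u³)`. -/
noncomputable def cubicPrimitive (u : ℝ) : ℝ := cubicLog u / 6 + cubicAngle u / √3

/-- A primitive of `u / (1 - u³)`. -/
noncomputable def cubicPrimitive' (u : ℝ) : ℝ := cubicLog u / 6 - cubicAngle u / √3

theorem one_sub_cube_pos {u : ℝ} (h : u < 1) : 0 < 1 - u ^ 3 := by
  nlinarith [sq_nonneg (u + 1 / 2), mul_pos (sub_pos.2 h) (by nlinarith [sq_nonneg (u + 1 / 2)] :
    0 < 1 + u + u ^ 2)]

theorem hasDerivAt_cubicAngle {u : ℝ} (h1 : -1 < u) (h2 : u < 1) :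
    HasDerivAt cubicAngle (√3 / 2 * ((1 - u) / (1 - u ^ 3))) u := by
  have hs : √3 ^ 2 = (3 : ℝ) := Real.sq_sqrt (by norm_num)
  have hc := (one_sub_cube_pos h2).ne'
  have hd : u + 2 ≠ 0 := by linarith
  have h := (((hasDerivAt_id u).const_mul √3).div ((hasDerivAt_id u).add_const 2) hd).arctan
  refine h.congr_deriv ?_
  simp only [id, Pi.div_apply]
  have h3 : (1 + (√3 * u / (u + 2)) ^ 2) = 4 * (1 + u + u ^ 2) / (u + 2) ^ 2 := by
    rw [div_pow, mul_pow, hs]; field_simp; ring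
  have h4 : 1 + u + u ^ 2 ≠ 0 := by nlinarith [sq_nonneg (u + 1 / 2)]
  rw [h3]
  have h5 : 1 - u ^ 3 = (1 - u) * (1 + u + u ^ 2) := by ring
  have h6 : 1 - u ≠ 0 := by linarith
  rw [h5]
  field_simp
  ring

theorem hasDerivAt_cubicLog {u : ℝ} (h2 : u < 1) :
    HasDerivAt cubicLog (3 * ((1 + u) / (1 - u ^ 3))) u := by
  have hc := (one_sub_cube_pos h2).ne'
  have h6 : 1 - u ≠ 0 := by linarith
  have hn : HasDerivAt (fun u : ℝ => 1 - u ^ 3) (-(3 * u ^ 2)) u := by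
    simpa using (hasDerivAt_pow 3 u).const_sub 1
  have hl : HasDerivAt (fun u : ℝ => (1 - u) ^ 3) (3 * (1 - u) ^ 2 * -1) u := by
    refine (((hasDerivAt_id u).const_sub 1).pow 3).congr_deriv ?_
    simp
  have h := (hn.div hl (pow_ne_zero 3 h6)).log (div_ne_zero hc (pow_ne_zero 3 h6))
  refine h.congr_deriv ?_
  simp only [Pi.div_apply]
  have h5 : 1 - u ^ 3 = (1 - u) * (1 + u + u ^ 2) := by ring
  have h4 : 1 + u + u ^ 2 ≠ 0 := by nlinarith [sq_nonneg (u + 1 / 2)]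
  rw [h5]
  field_simp
  ring

theorem hasDerivAt_cubicPrimitive {u : ℝ} (h1 : -1 < u) (h2 : u < 1) :
    HasDerivAt cubicPrimitive (1 / (1 - u ^ 3)) u := by
  have hs : √3 ≠ 0 := by positivity
  have hc := (one_sub_cube_pos h2).ne'
  refine (((hasDerivAt_cubicLog h2).div_const 6).add
    ((hasDerivAt_cubicAngle h1 h2).div_const √3)).congr_deriv ?_
  field_simp
  ring

theorem hasDerivAt_cubicPrimitive' {u : ℝ} (h1 : -1 < u) (h2 : u < 1) :
    HasDerivAt cubicPrimitive' (u / (1 - u ^ 3)) u := by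
  have hs : √3 ≠ 0 := by positivity
  have hc := (one_sub_cube_pos h2).ne'
  refine (((hasDerivAt_cubicLog h2).div_const 6).sub
    ((hasDerivAt_cubicAngle h1 h2).div_const √3)).congr_deriv ?_
  field_simp
  ring

theorem cubicPrimitive_zero : cubicPrimitive 0 = 0 := by
  simp [cubicPrimitive, cubicLog, cubicAngle]

theorem cubicPrimitive'_zero : cubicPrimitive' 0 = 0 := by
  simp [cubicPrimitive', cubicLog, cubicAngle]

/-- With `t = u³` the claim is `4 |t| < (1 - t)²`: for `t < 0` it reads `(1 + t)² > 0`, and for `t ≥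
0` it holds when `t < 3 - 2√2`, hence when `t < 1 / 8`. -/
theorem abs_cubicArg_lt {u : ℝ} (h1 : -1 < u) (h2 : u < 1 / 2) :
    4 / 27 * |cubicArg u| < 1 := by
  have hc := one_sub_cube_pos (show u < 1 by linarith)
  have h3 : u ^ 3 < 1 / 8 := by
    nlinarith [sq_nonneg (u + 1 / 4), mul_pos (sub_pos.2 h2)
      (by nlinarith [sq_nonneg (u + 1 / 4)] : 0 < u ^ 2 + u / 2 + 1 / 4)]
  have h4 : -1 < u ^ 3 := by
    have := one_sub_cube_pos (show -u < 1 by linarith)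
    linarith [show 1 - (-u) ^ 3 = 1 + u ^ 3 by ring]
  have h5 : |cubicArg u| < 27 / 4 := by
    rw [cubicArg, abs_lt, lt_div_iff₀ (by positivity), div_lt_iff₀ (by positivity)]
    constructor <;> nlinarith
  linarith

theorem hasDerivAt_one_sub_cube (u : ℝ) :
    HasDerivAt (fun u : ℝ => 1 - u ^ 3) (-(3 * u ^ 2)) u := by
  simpa using (hasDerivAt_pow 3 u).const_sub 1

theorem hasDerivAt_cubicArg {u : ℝ} (h2 : u < 1) :
    HasDerivAt cubicArg (-81 * u ^ 2 * (1 + u ^ 3) / (1 - u ^ 3) ^ 3) u := by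
  have hc := (one_sub_cube_pos h2).ne'
  refine (((hasDerivAt_pow 3 u).const_mul (-27)).div ((hasDerivAt_one_sub_cube u).pow 2)
    (pow_ne_zero 2 hc)).congr_deriv ?_
  simp only [Pi.pow_apply]
  field_simp
  push_cast
  ring

theorem hasDerivAt_powerSum_cubicArg {a : ℕ → ℝ} (ha : IsGeomBounded (4 / 27) a) {u : ℝ}
    (h1 : -1 < u) (h2 : u < 1 / 2) :
    HasDerivAt (fun u => powerSum a (cubicArg u))
      (powerSum (derivCoeff a) (cubicArg u) *
        (-81 * u ^ 2 * (1 + u ^ 3) / (1 - u ^ 3) ^ 3)) u :=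
  (hasDerivAt_powerSum (by norm_num) ha (abs_cubicArg_lt h1 h2)).comp u
    (hasDerivAt_cubicArg (by linarith))

/-- The left side `V` is `(1 - u³) / 3` times the `u`-derivative of `S(cubicArg u)`. The
differential equation makes `V''` rational; two integrations from `0` recover `V`. -/
theorem powerSum_derivCoeff_cubicArg {u : ℝ} (hu : u ∈ Set.Ioo (-1 : ℝ) (1 / 2)) :
    -27 * u ^ 2 * (1 + u ^ 3) / (1 - u ^ 3) ^ 2 *
        powerSum (derivCoeff invSqChoose) (cubicArg u) =
      -6 * (u * cubicPrimitive u + cubicPrimitive' u) := by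
  have hρ : (0 : ℝ) ≤ 4 / 27 := by norm_num
  have b1 := isGeomBounded_invSqChoose.derivCoeff hρ
  have b2 := b1.derivCoeff hρ
  -- The function here is `V'` expanded by the chain rule, and its derivative is `V''`.
  have hdiff : ∀ u ∈ Set.Ioo (-1 : ℝ) (1 / 2), HasDerivAt (fun u : ℝ =>
      -27 * (2 * u + 9 * u ^ 4 + u ^ 7) / (1 - u ^ 3) ^ 3 *
          powerSum (derivCoeff invSqChoose) (cubicArg u) +
        2187 * u ^ 4 * (1 + u ^ 3) ^ 2 / (1 - u ^ 3) ^ 5 *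
          powerSum (derivCoeff (derivCoeff invSqChoose)) (cubicArg u))
      (-18 * (1 + u ^ 3) / (1 - u ^ 3) ^ 2) u := by
    rintro u ⟨h1, h2⟩
    have hc := (one_sub_cube_pos (show u < 1 by linarith)).ne'
    have n1 : HasDerivAt (fun u : ℝ => -27 * (2 * u + 9 * u ^ 4 + u ^ 7))
        (-27 * (2 + 36 * u ^ 3 + 7 * u ^ 6)) u := by
      refine (((((hasDerivAt_id u).const_mul 2).add ((hasDerivAt_pow 4 u).const_mul 9)).add
        (hasDerivAt_pow 7 u)).const_mul (-27)).congr_deriv ?_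
      norm_num; ring
    have n2 : HasDerivAt (fun u : ℝ => 2187 * u ^ 4 * (1 + u ^ 3) ^ 2)
        (2187 * (4 * u ^ 3 * (1 + u ^ 3) ^ 2 + 6 * u ^ 6 * (1 + u ^ 3))) u := by
      refine (((hasDerivAt_pow 4 u).const_mul 2187).mul
        (((hasDerivAt_pow 3 u).const_add 1).pow 2)).congr_deriv ?_
      simp only [Pi.pow_apply]
      norm_num; ring
    have d1 := (n1.div ((hasDerivAt_one_sub_cube u).pow 3) (pow_ne_zero 3 hc)).mul
      (hasDerivAt_powerSum_cubicArg b1 h1 h2)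
    have d2 := (n2.div ((hasDerivAt_one_sub_cube u).pow 5) (pow_ne_zero 5 hc)).mul
      (hasDerivAt_powerSum_cubicArg b2 h1 h2)
    refine (d1.add d2).congr_deriv ?_
    have ode := powerSum_invSqChoose_ode (abs_cubicArg_lt h1 h2)
    simp only [Pi.pow_apply, Pi.div_apply]
    generalize powerSum (derivCoeff (derivCoeff (derivCoeff invSqChoose))) (cubicArg u) = w2 at *
    generalize powerSum (derivCoeff (derivCoeff invSqChoose)) (cubicArg u) = w1 at *
    generalize powerSum (derivCoeff invSqChoose) (cubicArg u) = w0 at *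
    -- `V''` is the left side of the differential equation times this factor.
    have hκ : -18 * (1 + u ^ 3) / (1 - u ^ 3) ^ 2 = (-9 * (1 + u ^ 3) / (1 - u ^ 3) ^ 2) * 2 := by
      ring
    refine Eq.trans ?_ ((congrArg (fun t => -9 * (1 + u ^ 3) / (1 - u ^ 3) ^ 2 * t) ode).trans
      hκ.symm)
    rw [cubicArg]
    norm_num
    field_simp
    ring
  have hV1 : Set.EqOn (fun u : ℝ => -27 * (2 * u + 9 * u ^ 4 + u ^ 7) / (1 - u ^ 3) ^ 3 *
          powerSum (derivCoeff invSqChoose) (cubicArg u) +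
        2187 * u ^ 4 * (1 + u ^ 3) ^ 2 / (1 - u ^ 3) ^ 5 *
          powerSum (derivCoeff (derivCoeff invSqChoose)) (cubicArg u))
      (fun u => -6 * (cubicPrimitive u + 2 * u / (1 - u ^ 3))) (Set.Ioo (-1) (1 / 2)) := by
    refine eqOn_Ioo_of_hasDerivAt (by norm_num) (by norm_num) hdiff ?_ ?_
    · rintro u ⟨h1, h2⟩
      have hc := (one_sub_cube_pos (show u < 1 by linarith)).ne'
      refine (((hasDerivAt_cubicPrimitive h1 (by linarith)).add
        (((hasDerivAt_id u).const_mul 2).div (hasDerivAt_one_sub_cube u) hc)).const_mul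
          (-6)).congr_deriv ?_
      simp only [id]
      field_simp
      ring
    · simp [cubicPrimitive_zero]
  refine eqOn_Ioo_of_hasDerivAt (f := fun u => -27 * u ^ 2 * (1 + u ^ 3) / (1 - u ^ 3) ^ 2 *
        powerSum (derivCoeff invSqChoose) (cubicArg u))
      (g := fun u => -6 * (u * cubicPrimitive u + cubicPrimitive' u))
      (f' := fun u => -6 * (cubicPrimitive u + 2 * u / (1 - u ^ 3)))
      (by norm_num) (by norm_num) ?_ ?_ ?_ hu
  · rintro u ⟨h1, h2⟩
    have hc := (one_sub_cube_pos (show u < 1 by linarith)).ne'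
    have n0 : HasDerivAt (fun u : ℝ => -27 * u ^ 2 * (1 + u ^ 3))
        (-27 * (2 * u + 5 * u ^ 4)) u := by
      refine (((hasDerivAt_pow 2 u).const_mul (-27)).mul
        ((hasDerivAt_pow 3 u).const_add 1)).congr_deriv ?_
      norm_num; ring
    refine ((n0.div ((hasDerivAt_one_sub_cube u).pow 2) (pow_ne_zero 2 hc)).mul
      (hasDerivAt_powerSum_cubicArg b1 h1 h2)).congr_deriv ?_
    refine Eq.trans ?_ (hV1 ⟨h1, h2⟩)
    simp only [Pi.pow_apply, Pi.div_apply]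
    norm_num
    field_simp
    ring
  · rintro u ⟨h1, h2⟩
    have hc := (one_sub_cube_pos (show u < 1 by linarith)).ne'
    refine ((((hasDerivAt_id u).mul (hasDerivAt_cubicPrimitive h1 (by linarith))).add
      (hasDerivAt_cubicPrimitive' h1 (by linarith))).const_mul (-6)).congr_deriv ?_
    simp only [id]
    field_simp
    ring
  · simp [cubicPrimitive'_zero]

theorem powerSum_invSqChoose_cubicArg {u : ℝ} (hu : u ∈ Set.Ioo (-1 : ℝ) (1 / 2)) :
    powerSum invSqChoose (cubicArg u) = 6 * cubicAngle u ^ 2 - 1 / 2 * cubicLog u ^ 2 := by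
  have h : powerSum invSqChoose (cubicArg u) = -18 * (cubicPrimitive u * cubicPrimitive' u) := by
    refine eqOn_Ioo_of_hasDerivAt (f := fun u => powerSum invSqChoose (cubicArg u))
      (g := fun u => -18 * (cubicPrimitive u * cubicPrimitive' u)) (by norm_num) (by norm_num)
      (fun u hu => hasDerivAt_powerSum_cubicArg isGeomBounded_invSqChoose hu.1 hu.2) ?_ ?_ hu
    · rintro u ⟨h1, h2⟩
      have hc := (one_sub_cube_pos (show u < 1 by linarith)).ne'
      refine (((hasDerivAt_cubicPrimitive h1 (by linarith)).mul
        (hasDerivAt_cubicPrimitive' h1 (by linarith))).const_mul (-18)).congr_deriv ?_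
      have h := powerSum_derivCoeff_cubicArg ⟨h1, h2⟩
      field_simp at h ⊢
      linear_combination (-3) * h
    · have : powerSum invSqChoose 0 = 0 := by
        rw [powerSum]
        refine (tsum_congr fun n => ?_).trans tsum_zero
        rcases n with _ | n <;> simp [invSqChoose]
      simp [cubicPrimitive_zero, cubicArg, this]
  -- The product of the two primitives is a difference of squares, `L² / 36 - A² / 3`.
  have hs : (√3)⁻¹ ^ 2 = (1 / 3 : ℝ) := by
    rw [inv_pow, Real.sq_sqrt (by norm_num), one_div]
  rw [h, cubicPrimitive, cubicPrimitive', div_eq_mul_inv (cubicAngle u)]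
  linear_combination (18 * cubicAngle u ^ 2) * hs

theorem hasSum_inv_sq_mul_choose {u : ℝ} (hu : u ∈ Set.Ioo (-1 : ℝ) (1 / 2)) :
    HasSum (fun n : ℕ => cubicArg u ^ (n + 1) *
        (1 / (((n : ℝ) + 1) ^ 2 * (Nat.choose (3 * (n + 1)) (n + 1) : ℝ))))
      (6 * cubicAngle u ^ 2 - 1 / 2 * cubicLog u ^ 2) := by
  have hs := (isGeomBounded_invSqChoose.summable (by norm_num)
    (abs_cubicArg_lt hu.1 hu.2)).hasSum
  rw [← hasSum_nat_add_iff' 1] at hs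
  change HasSum _ (powerSum _ _ - _) at hs
  rw [powerSum_invSqChoose_cubicArg hu] at hs
  simp only [Finset.sum_range_one] at hs
  have h0 : invSqChoose 0 = 0 := by simp [invSqChoose]
  rw [h0, zero_mul, sub_zero] at hs
  refine hs.congr_fun fun n => ?_
  rw [invSqChoose]; push_cast; ring

/-! ### Cube roots, Binet formulas and bounds on Fibonacci ratios -/

theorem cubeRoot_eq_of_pow_three {x y : ℝ} (h : y ^ 3 = x) : cubeRoot x = y :=
  (Odd.strictMono_pow (by decide : Odd 3)).injective ((cubeRoot_pow_three x).trans h.symm)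

theorem cubeRoot_mul (x y : ℝ) : cubeRoot (x * y) = cubeRoot x * cubeRoot y :=
  cubeRoot_eq_of_pow_three (by rw [mul_pow, cubeRoot_pow_three, cubeRoot_pow_three])

theorem cubeRoot_ne_zero {x : ℝ} (h : x ≠ 0) : cubeRoot x ≠ 0 := by
  intro h0
  apply h
  rw [← cubeRoot_pow_three x, h0]; norm_num

theorem lucasNat_eq (n : ℕ) :
    (lucasNat n : ℝ) = Real.goldenRatio ^ n + Real.goldenConj ^ n := by
  induction n using Nat.twoStepInduction with
  | zero => norm_num [lucasNat]
  | one => simp [lucasNat, Real.goldenRatio_add_goldenConj]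
  | more n h0 h1 =>
    rw [lucasNat]; push_cast
    rw [h0, h1, pow_add _ n 2, pow_add _ n 2, Real.goldenRatio_sq, Real.goldenConj_sq]
    ring

theorem lucasInt_eq (n : ℤ) :
    (lucasInt n : ℝ) = Real.goldenRatio ^ n + Real.goldenConj ^ n := by
  rcases le_or_gt 0 n with h | h
  · lift n to ℕ using h
    simp [lucasInt, lucasNat_eq]
  · obtain ⟨k, rfl⟩ : ∃ k : ℕ, n = -(k : ℤ) := ⟨n.natAbs, by omega⟩
    rw [lucasInt, if_neg (by omega)]
    push_cast
    rw [Int.natAbs_neg, Int.natAbs_natCast, lucasNat_eq, zpow_neg, zpow_neg, zpow_natCast,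
      zpow_natCast, ← inv_pow, ← inv_pow, Real.inv_goldenRatio, Real.inv_goldenConj, mul_add,
      ← mul_pow, ← mul_pow]
    ring

theorem goldenConj_zpow (n : ℤ) :
    Real.goldenConj ^ n = (-1) ^ n / Real.goldenRatio ^ n := by
  rw [← div_zpow, ← Real.goldenRatio_mul_goldenConj,
    mul_div_cancel_left₀ _ Real.goldenRatio_pos.ne']

/-- From `F_{m+1} - β F_m = α^m` and `β < 0`. -/
theorem goldenRatio_mul_fib_le (m : ℕ) (hm : 1 ≤ m) :
    Real.goldenRatio * Nat.fib m ≤ Real.goldenRatio ^ m := by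
  obtain ⟨m, rfl⟩ := Nat.exists_eq_add_of_le' hm
  have h := Real.fib_succ_sub_goldenConj_mul_fib m
  have h1 := Real.goldenConj_neg
  have h2 : (0 : ℝ) ≤ Nat.fib m := Nat.cast_nonneg _
  rw [pow_succ']
  have := Real.goldenRatio_pos
  gcongr
  nlinarith

/-- The absolute value is at most `1 / (α^(n+1) F_n)`. For even `n` the ratio is negative and only
`-1` matters; for odd `n` one has `n ≥ 3`, so `α^(n+1) F_n ≥ 2 α⁴ > 8`. -/
theorem fib_ratio_mem_Ioo {n m : ℕ} (hn : 2 ≤ n) (hm : 2 ≤ m) :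
    (-1) ^ (n + 1) * (Nat.fib m : ℝ) / (Real.goldenRatio ^ (n + m) * Nat.fib n) ∈
      Set.Ioo (-1 : ℝ) (1 / 8) := by
  have hφ := Real.one_lt_goldenRatio
  have hFm : (0 : ℝ) < Nat.fib m := by exact_mod_cast Nat.fib_pos.2 (by omega)
  have hFn : (1 : ℝ) ≤ Nat.fib n := by exact_mod_cast Nat.fib_pos.2 (by omega)
  have hden : 0 < Real.goldenRatio ^ (n + m) * Nat.fib n := by
    have := Real.goldenRatio_pos; positivity
  have hkey : Real.goldenRatio ^ (n + 1) * Nat.fib n * Nat.fib m ≤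
      Real.goldenRatio ^ (n + m) * Nat.fib n := by
    have h1 := goldenRatio_mul_fib_le m (by omega)
    have := Real.goldenRatio_pos
    calc Real.goldenRatio ^ (n + 1) * Nat.fib n * Nat.fib m
        = Real.goldenRatio ^ n * (Real.goldenRatio * Nat.fib m) * Nat.fib n := by ring
      _ ≤ Real.goldenRatio ^ n * Real.goldenRatio ^ m * Nat.fib n := by gcongr
      _ = _ := by ring
  rw [Set.mem_Ioo, lt_div_iff₀ hden, div_lt_iff₀ hden]
  rcases Nat.even_or_odd n with he | ho
  · rw [(he.add_one).neg_one_pow]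
    have h1 : 1 < Real.goldenRatio ^ (n + 1) := one_lt_pow₀ hφ (by omega)
    have h2 : 1 < Real.goldenRatio ^ (n + 1) * Nat.fib n := by nlinarith
    constructor <;> nlinarith
  · rw [(ho.add_one).neg_one_pow]
    have h3 : 3 ≤ n := by
      obtain ⟨k, rfl⟩ := ho; omega
    have h1 : Real.goldenRatio ^ 4 ≤ Real.goldenRatio ^ (n + 1) :=
      pow_le_pow_right₀ hφ.le (by omega)
    have h4 : Real.goldenRatio ^ 4 = 3 * Real.goldenRatio + 2 := by
      linear_combination
        (Real.goldenRatio ^ 2 + Real.goldenRatio + 2) * Real.goldenRatio_sq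
    have hF2 : (2 : ℝ) ≤ Nat.fib n := by exact_mod_cast Nat.fib_mono h3
    have h2 : 8 < Real.goldenRatio ^ (n + 1) * Nat.fib n := by nlinarith
    constructor <;> nlinarith

theorem mem_Ioo_of_pow_three_mem {u : ℝ} (h : u ^ 3 ∈ Set.Ioo (-1 : ℝ) (1 / 8)) :
    u ∈ Set.Ioo (-1 : ℝ) (1 / 2) := by
  have hm := Odd.strictMono_pow (R := ℝ) (by decide : Odd 3)
  exact ⟨hm.lt_iff_lt.1 (by simpa using by linarith [h.1]),
    hm.lt_iff_lt.1 (by norm_num; linarith [h.2])⟩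

theorem cubicArg_div {c d : ℝ} (hd : d ≠ 0) (hcd : c / d < 1) :
    cubicArg (c / d) = -27 * c ^ 3 * d ^ 3 / (d ^ 3 - c ^ 3) ^ 2 := by
  have h := (one_sub_cube_pos hcd).ne'
  have h1 : d ^ 3 - c ^ 3 ≠ 0 := by
    intro h2; apply h; field_simp; rw [h2, mul_zero]
  rw [cubicArg]
  have h3 : 1 - (c / d) ^ 3 = (d ^ 3 - c ^ 3) / d ^ 3 := by field_simp
  rw [h3]
  field_simp

theorem cubicAngle_div {c d : ℝ} (hd : d ≠ 0) :
    cubicAngle (c / d) = Real.arctan (√3 * c / (2 * d + c)) := by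
  rw [cubicAngle, show c / d + 2 = (2 * d + c) / d by field_simp; ring, ← mul_div_assoc,
    div_div_div_cancel_right₀ hd]

theorem cubicLog_div {c d : ℝ} (hd : d ≠ 0) :
    cubicLog (c / d) = Real.log ((d ^ 3 - c ^ 3) / (d - c) ^ 3) := by
  rw [cubicLog, show 1 - (c / d) ^ 3 = (d ^ 3 - c ^ 3) / d ^ 3 by field_simp,
    show (1 - c / d) ^ 3 = (d - c) ^ 3 / d ^ 3 by field_simp,
    div_div_div_cancel_right₀ (pow_ne_zero 3 hd)]

/-- This is `F_{p+q} - α^q F_p = β^p F_q` times `α^p`; it evaluates `1 - u³`. The primed version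
plays the same role for the conjugate series. -/
theorem goldenRatio_zpow_mul_fib_add_sub (p q : ℤ) :
    Real.goldenRatio ^ p * (Int.fib (p + q) - Real.goldenRatio ^ q * Int.fib p) =
      (-1) ^ p * Int.fib q := by
  have hφ := Real.goldenRatio_pos.ne'
  have h5 : √5 ≠ 0 := by positivity
  rw [Real.coe_intFib_eq, Real.coe_intFib_eq, Real.coe_intFib_eq, goldenConj_zpow,
    goldenConj_zpow, goldenConj_zpow, zpow_add₀ hφ, zpow_add₀ (by norm_num)]
  have ha : Real.goldenRatio ^ p ≠ 0 := zpow_ne_zero _ hφ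
  have hb : Real.goldenRatio ^ q ≠ 0 := zpow_ne_zero _ hφ
  generalize Real.goldenRatio ^ p = a at *
  generalize Real.goldenRatio ^ q = b at *
  field_simp
  ring

theorem goldenRatio_zpow_mul_fib_add_sub' (p q : ℤ) :
    Real.goldenRatio ^ q * Int.fib (p + q) - (-1) ^ q * Int.fib p =
      Real.goldenRatio ^ (p + q) * Int.fib q := by
  have hφ := Real.goldenRatio_pos.ne'
  have h5 : √5 ≠ 0 := by positivity
  rw [Real.coe_intFib_eq, Real.coe_intFib_eq, Real.coe_intFib_eq, goldenConj_zpow,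
    goldenConj_zpow, goldenConj_zpow, zpow_add₀ hφ, zpow_add₀ (by norm_num)]
  have ha : Real.goldenRatio ^ p ≠ 0 := zpow_ne_zero _ hφ
  have hb : Real.goldenRatio ^ q ≠ 0 := zpow_ne_zero _ hφ
  generalize Real.goldenRatio ^ p = a at *
  generalize Real.goldenRatio ^ q = b at *
  field_simp
  ring

theorem neg_one_zpow_mul_self (n : ℤ) : ((-1 : ℝ) ^ n) * (-1) ^ n = 1 := by
  rw [← mul_zpow]; norm_num

theorem exists_nat_of_index_bounds {p q : ℤ} (hp : p ≤ -2) (hpq : |p| + 1 < q) :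
    ∃ n m : ℕ, 2 ≤ n ∧ 2 ≤ m ∧ p = -(n : ℤ) ∧ q = ((n + m : ℕ) : ℤ) := by
  rw [abs_of_neg (by omega)] at hpq
  exact ⟨p.natAbs, (p + q).natAbs, by omega, by omega, by omega, by omega⟩

theorem fib_index_ratio_mem_Ioo {p q : ℤ} (hp : p ≤ -2) (hpq : |p| + 1 < q) :
    (Int.fib (p + q) : ℝ) / (Real.goldenRatio ^ q * Int.fib p) ∈ Set.Ioo (-1 : ℝ) (1 / 8) := by
  obtain ⟨n, m, hn, hm, rfl, rfl⟩ := exists_nat_of_index_bounds hp hpq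
  have h := fib_ratio_mem_Ioo hn hm
  convert h using 1
  rw [show -(n : ℤ) + ((n + m : ℕ) : ℤ) = (m : ℤ) by push_cast; ring, Int.fib_neg_natCast,
    Int.fib_natCast, zpow_natCast]
  push_cast
  have he : ((-1 : ℝ) ^ (n + 1)) * (-1) ^ (n + 1) = 1 := by rw [← mul_pow]; norm_num
  have he0 : ((-1 : ℝ) ^ (n + 1)) ≠ 0 := by positivity
  rw [← mul_div_mul_left _ _ he0, mul_left_comm (Real.goldenRatio ^ (n + m)), ← mul_assoc _ _
    (Real.goldenRatio ^ (n + m) * _), he, one_mul]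

theorem fib_index_ratio_mem_Ioo' {p q : ℤ} (hp : p ≤ -2) (hpq : |p| + 1 < q) :
    ((-1) ^ q * Int.fib p : ℝ) / (Real.goldenRatio ^ q * Int.fib (p + q)) ∈
      Set.Ioo (-1 : ℝ) (1 / 8) := by
  obtain ⟨n, m, hn, hm, rfl, rfl⟩ := exists_nat_of_index_bounds hp hpq
  -- The roles of `n` and `m` are exchanged: `(-1)^(n+m) (-1)^(n+1) = (-1)^(m+1)`.
  have h := fib_ratio_mem_Ioo hm hn
  convert h using 1
  rw [show -(n : ℤ) + ((n + m : ℕ) : ℤ) = (m : ℤ) by push_cast; ring, Int.fib_neg_natCast,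
    Int.fib_natCast, zpow_natCast, zpow_natCast]
  push_cast
  have he : ((-1 : ℝ) ^ n) * (-1) ^ n = 1 := by rw [← mul_pow]; norm_num
  rw [← mul_assoc, show (-1 : ℝ) ^ (n + m) * (-1) ^ (n + 1) = ((-1) ^ n * (-1) ^ n) *
    (-1) ^ (m + 1) by ring, he, one_mul, add_comm n m]

theorem pow_mul_zpow_mul_div {x y g C : ℝ} {k : ℤ} (n : ℕ) (h : x * g ^ k = y) :
    x ^ (n + 1) * (g ^ (k * ((n : ℤ) + 1)) / C) = y ^ (n + 1) * (1 / C) := by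
  rw [← h, mul_pow, zpow_mul, ← Nat.cast_succ, zpow_natCast, Nat.succ_eq_add_one]
  ring

/-! ### Specialization to Fibonacci and Lucas numbers -/

/-- The series at the index `2 p + q` with every Fibonacci number replaced by a power of the
golden ratio. -/
theorem hasSum_goldenRatio {p q : ℤ} (hp : p ≤ -2) (hpq : |p| + 1 < q) :
    HasSum
      (fun n : ℕ =>
        (-27 * (Int.fib p : ℝ) * (Int.fib (p + q) : ℝ) / (Int.fib q : ℝ) ^ 2) ^ (n + 1) *
          (Real.goldenRatio ^ ((2 * p + q) * ((n : ℤ) + 1)) /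
            (((n : ℝ) + 1) ^ 2 * (Nat.choose (3 * (n + 1)) (n + 1) : ℝ))))
      (6 * Real.arctan
              (√3 * cubeRoot (Int.fib (p + q)) /
                (2 * cubeRoot (Real.goldenRatio ^ q * Int.fib p) +
                  cubeRoot (Int.fib (p + q)))) ^ 2 -
        1 / 2 * Real.log
              ((-1) ^ p * Int.fib q /
                (cubeRoot (Real.goldenRatio ^ p * Int.fib (p + q)) -
                  cubeRoot (Real.goldenRatio ^ (p + q) * Int.fib p)) ^ 3) ^ 2) := by
  have hφ := Real.goldenRatio_pos.ne'
  have hr := fib_index_ratio_mem_Ioo hp hpq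
  have H := goldenRatio_zpow_mul_fib_add_sub p q
  have hfp : (Int.fib p : ℝ) ≠ 0 := by
    rw [Int.cast_ne_zero, Ne, Int.fib_eq_zero]; omega
  have hfq : (Int.fib q : ℝ) ≠ 0 := by
    rw [Int.cast_ne_zero, Ne, Int.fib_eq_zero]; have := abs_nonneg p; omega
  have ha : Real.goldenRatio ^ p ≠ 0 := zpow_ne_zero _ hφ
  have hb : Real.goldenRatio ^ q ≠ 0 := zpow_ne_zero _ hφ
  have hd := cubeRoot_ne_zero (mul_ne_zero hb hfp)
  have hd3 := cubeRoot_pow_three (Real.goldenRatio ^ q * Int.fib p)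
  have hc3 := cubeRoot_pow_three (Int.fib (p + q))
  have hu : cubeRoot (Int.fib (p + q)) / cubeRoot (Real.goldenRatio ^ q * Int.fib p) ∈
      Set.Ioo (-1 : ℝ) (1 / 2) := mem_Ioo_of_pow_three_mem (by rwa [div_pow, hc3, hd3])
  have hs := hasSum_inv_sq_mul_choose hu
  rw [cubicAngle_div hd, cubicLog_div hd, cubicArg_div hd (by linarith [hu.2]), hc3, hd3] at hs
  have he := neg_one_zpow_mul_self p
  convert hs using 1
  · ext n
    refine pow_mul_zpow_mul_div n ?_
    have hne : (Real.goldenRatio ^ q * Int.fib p - Int.fib (p + q) : ℝ) ≠ 0 := by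
      intro h0
      apply mul_ne_zero (left_ne_zero_of_mul_eq_one he) hfq
      rw [← H]; linear_combination (-Real.goldenRatio ^ p) * h0
    rw [zpow_add₀ hφ, two_mul, zpow_add₀ hφ, div_mul_eq_mul_div,
      div_eq_div_iff (pow_ne_zero 2 hfq) (pow_ne_zero 2 hne)]
    -- Squaring the identity `H` removes the sign `(-1)^p`.
    have H2 : (Real.goldenRatio ^ p) ^ 2 * (Real.goldenRatio ^ q * Int.fib p -
        Int.fib (p + q) : ℝ) ^ 2 = Int.fib q ^ 2 := by
      calc _ = (Real.goldenRatio ^ p *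
            (Int.fib (p + q) - Real.goldenRatio ^ q * Int.fib p)) ^ 2 := by ring
        _ = ((-1) ^ p * (-1) ^ p) * Int.fib q ^ 2 := by rw [H]; ring
        _ = _ := by rw [he, one_mul]
    linear_combination (-27 * Int.fib p * Int.fib (p + q) * Real.goldenRatio ^ q : ℝ) * H2
  · congr 4
    -- A common factor `α^p` cancels in the logarithm; then numerator and denominator change sign
    -- together.
    rw [cubeRoot_mul, zpow_add₀ hφ, mul_assoc, cubeRoot_mul (Real.goldenRatio ^ p), ← H, ← mul_sub,
      mul_pow, cubeRoot_pow_three, mul_div_mul_left _ _ ha,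
      ← neg_sub (Real.goldenRatio ^ q * (Int.fib p : ℝ)),
      ← neg_sub (cubeRoot (Real.goldenRatio ^ q * Int.fib p)), Odd.neg_pow (by decide), neg_div_neg_eq]

/-- The series at the index `2 p + q` with every Fibonacci number replaced by a power of the
conjugate of the golden ratio. -/
theorem hasSum_goldenConj {p q : ℤ} (hp : p ≤ -2) (hpq : |p| + 1 < q) :
    HasSum
      (fun n : ℕ =>
        (-27 * (Int.fib p : ℝ) * (Int.fib (p + q) : ℝ) / (Int.fib q : ℝ) ^ 2) ^ (n + 1) *
          (Real.goldenConj ^ ((2 * p + q) * ((n : ℤ) + 1)) /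
            (((n : ℝ) + 1) ^ 2 * (Nat.choose (3 * (n + 1)) (n + 1) : ℝ))))
      (6 * Real.arctan
              (√3 * cubeRoot (Int.fib p) /
                (2 * cubeRoot (Real.goldenRatio ^ q * Int.fib (p + q)) +
                  (-1) ^ q * cubeRoot (Int.fib p))) ^ 2 -
        1 / 2 * Real.log
              (Real.goldenRatio ^ (p + q) * Int.fib q /
                (cubeRoot (Real.goldenRatio ^ q * Int.fib (p + q)) -
                  (-1) ^ q * cubeRoot (Int.fib p)) ^ 3) ^ 2) := by
  have hφ := Real.goldenRatio_pos.ne'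
  have hr := fib_index_ratio_mem_Ioo' hp hpq
  have H := goldenRatio_zpow_mul_fib_add_sub' p q
  have hfm : (Int.fib (p + q) : ℝ) ≠ 0 := by
    rw [Int.cast_ne_zero, Ne, Int.fib_eq_zero]; have := neg_abs_le p; omega
  have hfq : (Int.fib q : ℝ) ≠ 0 := by
    rw [Int.cast_ne_zero, Ne, Int.fib_eq_zero]; have := abs_nonneg p; omega
  have ha : Real.goldenRatio ^ p ≠ 0 := zpow_ne_zero _ hφ
  have hb : Real.goldenRatio ^ q ≠ 0 := zpow_ne_zero _ hφ
  have hd := cubeRoot_ne_zero (mul_ne_zero hb hfm)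
  have hd3 := cubeRoot_pow_three (Real.goldenRatio ^ q * Int.fib (p + q))
  have he := neg_one_zpow_mul_self q
  have hc3 : ((-1) ^ q * cubeRoot (Int.fib p)) ^ 3 = (-1) ^ q * Int.fib p := by
    rw [mul_pow, cubeRoot_pow_three]
    linear_combination ((-1) ^ q * Int.fib p : ℝ) * he
  have hu : (-1) ^ q * cubeRoot (Int.fib p) / cubeRoot (Real.goldenRatio ^ q * Int.fib (p + q)) ∈
      Set.Ioo (-1 : ℝ) (1 / 2) := mem_Ioo_of_pow_three_mem (by rwa [div_pow, hc3, hd3])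
  have hs := hasSum_inv_sq_mul_choose hu
  rw [cubicAngle_div hd, cubicLog_div hd, cubicArg_div hd (by linarith [hu.2]), hc3, hd3, H] at hs
  convert hs using 1
  · ext n
    refine pow_mul_zpow_mul_div n ?_
    rw [goldenConj_zpow, zpow_add₀ hφ, two_mul, zpow_add₀ hφ, zpow_add₀ hφ,
      zpow_add₀ (by norm_num), zpow_add₀ (by norm_num), neg_one_zpow_mul_self]
    field_simp
  · congr 2
    -- The sign `(-1)^q` in the numerator disappears because `arctan` is odd and squared.
    rcases mul_self_eq_one_iff.1 he with h | h
    · simp only [h, one_mul]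
    · simp only [h, neg_one_mul, mul_neg, neg_div, Real.arctan_neg, even_two, Even.neg_pow]

theorem theorem8 (p q : ℤ) (hp : p ≤ -2) (hq : 4 ≤ q) (hpq : |p| + 1 < q) :
    HasSum
      (fun n : ℕ =>
        (-27 * (Int.fib p : ℝ) * (Int.fib (p + q) : ℝ) / (Int.fib q : ℝ) ^ 2) ^ (n + 1) *
          ((Int.fib ((2 * p + q) * ((n : ℤ) + 1)) : ℝ) /
            (((n : ℝ) + 1) ^ 2 * (Nat.choose (3 * (n + 1)) (n + 1) : ℝ))))
      (6 / √5 *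
          (Real.arctan
              (√3 * cubeRoot (Int.fib (p + q)) /
                (2 * cubeRoot (Real.goldenRatio ^ q * Int.fib p) +
                  cubeRoot (Int.fib (p + q)))) ^ 2 -
            Real.arctan
              (√3 * cubeRoot (Int.fib p) /
                (2 * cubeRoot (Real.goldenRatio ^ q * Int.fib (p + q)) +
                  (-1) ^ q * cubeRoot (Int.fib p))) ^ 2) -
        √5 / 10 *
          (Real.log
              ((-1) ^ p * Int.fib q /
                (cubeRoot (Real.goldenRatio ^ p * Int.fib (p + q)) -
                  cubeRoot (Real.goldenRatio ^ (p + q) * Int.fib p)) ^ 3) ^ 2 -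
            Real.log
              (Real.goldenRatio ^ (p + q) * Int.fib q /
                (cubeRoot (Real.goldenRatio ^ q * Int.fib (p + q)) -
                  (-1) ^ q * cubeRoot (Int.fib p)) ^ 3) ^ 2)) ∧
    HasSum
      (fun n : ℕ =>
        (-27 * (Int.fib p : ℝ) * (Int.fib (p + q) : ℝ) / (Int.fib q : ℝ) ^ 2) ^ (n + 1) *
          ((lucasInt ((2 * p + q) * ((n : ℤ) + 1)) : ℝ) /
            (((n : ℝ) + 1) ^ 2 * (Nat.choose (3 * (n + 1)) (n + 1) : ℝ))))
      (6 *
          (Real.arctan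
              (√3 * cubeRoot (Int.fib (p + q)) /
                (2 * cubeRoot (Real.goldenRatio ^ q * Int.fib p) +
                  cubeRoot (Int.fib (p + q)))) ^ 2 +
            Real.arctan
              (√3 * cubeRoot (Int.fib p) /
                (2 * cubeRoot (Real.goldenRatio ^ q * Int.fib (p + q)) +
                  (-1) ^ q * cubeRoot (Int.fib p))) ^ 2) -
        1 / 2 *
          (Real.log
              ((-1) ^ p * Int.fib q /
                (cubeRoot (Real.goldenRatio ^ p * Int.fib (p + q)) -
                  cubeRoot (Real.goldenRatio ^ (p + q) * Int.fib p)) ^ 3) ^ 2 +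
            Real.log
              (Real.goldenRatio ^ (p + q) * Int.fib q /
                (cubeRoot (Real.goldenRatio ^ q * Int.fib (p + q)) -
                  (-1) ^ q * cubeRoot (Int.fib p)) ^ 3) ^ 2)) := by
  have h5 : √5 ^ 2 = (5 : ℝ) := Real.sq_sqrt (by norm_num)
  have h50 : √5 ≠ 0 := by positivity
  have h1 := hasSum_goldenRatio hp hpq
  have h2 := hasSum_goldenConj hp hpq
  constructor
  · convert (h1.sub h2).div_const √5 using 1
    · rfl
    · ext n
      rw [Real.coe_intFib_eq ((2 * p + q) * ((n : ℤ) + 1))]; ring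
    · rw [show √5 / 10 = 1 / 2 / √5 by field_simp; rw [h5]; norm_num]
      ring
  · convert h1.add h2 using 1
    · ext n
      rw [lucasInt_eq]; ring
    · ring
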